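/- Let $I=(0,\infty)$ and $dm=2x^2\,dx$ on $I$. Let $\mathcal E$ be the Dirichlet form in $L^2(I,m)$ of the three-dimensional Bessel process, $$\mathcal D=\Big\{u\in L^2(I,m):\ u \text{ locally absolutely continuous on } I,\ \int_0^\infty (u'(x))^2x^2\,dx<\infty\Big\},\qquad \mathcal E[u]=\int_0^\infty (u'(x))^2x^2\,dx .$$ Let $\mathbb N=\{1,2,3,\dots\}$, let $(a_k)_{k\in\mathbb N}$ be real numbers with $a_k>0$ for all $k$, and let $\mu=\sum_{k\in\mathbb N}a_k\delta_k$. Let $J$ be the restriction operator $Ju=u|_{\mathbb N}$ with domain $D(J)=\{u\in\mathcal D:\sum_k a_ku(k)^2<\infty\}$ and values in $\ell^2(\mathbb N,\mu)$. For $\lambda>0$ put $\mathcal E_\lambda[u]=\mathcal E[u]+\lambda\|u\|_{L^2(I,m)}^2$, let $P_\lambda$ be the orthogonal projection in $(\mathcal D,\mathcal E_\lambda)$ onto the $\mathcal E_\lambda$-orthogonal complement of $\ker J=\{u\in\mathcal D:u(k)=0\ \forall k\in\mathbb N\}$, and let $\check{\mathcal E}_\lambda$ be the form on $\ell^2(\mathbb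 N,\mu)$ given by $\check{\mathcal E}_\lambda[Ju]=\mathcal E_\lambda[P_\lambda u]$ for $u\in D(J)$ (and $+\infty$ off the range of $J$). The trace form $\check{\mathcal E}$ of $\mathcal E$ with respect to $\mu$ is the Mosco limit of $\check{\mathcal E}_\lambda$ as $\lambda\downarrow0$, and $\check{\mathcal D}=\{f\in \ell^2(\mathbb N,\mu):\check{\mathcal E}[f]<\infty\}$ is its domain, with the norm $\big(\check{\mathcal E}[f]+\|f\|_{\ell^2(\mathbb N,\mu)}^2\big)^{1/2}$. Let $p\in[1,\infty)$ be such that $$\sum_{k\in\mathbb N}\frac{a_k}{k^{p/2}}<\infty .$$ Then $\check{\mathcal D}$ embeds compactly into $\ell^p(\mathbb N,\mu)$: $\check{\mathcal D}\subset\ell^p(\mathbb N,\mu)$, the inclusion is bounded, and every bounded sequence in $\check{\mathcal D}$ has a subsequence which converges in $\ell^p(\mathbb N,\mu)$. -/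

import Mathlib

open MeasureTheory Filter Set Topology
open scoped ENNReal NNReal

noncomputable section

/-! ### The Bessel Dirichlet form in dimension three -/

/-- The speed measure `dm = 2 x² dx` on the half-line `I = (0, ∞)`. -/
def besselMeasure : Measure ℝ :=
  (volume.restrict (Ioi (0 : ℝ))).withDensity fun x => ENNReal.ofReal (2 * x ^ 2)

/-- The domain of the Bessel Dirichlet form: functions `u` on `I` which are (locally) absolutely
continuous on `I`, lie in `L²(I, m)` and satisfy `∫_I (u')² x² dx < ∞`. A function on `I` is
represented by a function on `ℝ` whose values outside `I` play no role. -/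
def BesselDomain : Set (ℝ → ℝ) :=
  {u | (∀ b c : ℝ, 0 < b → b ≤ c → AbsolutelyContinuousOnInterval u b c) ∧
    IntegrableOn (fun x => (deriv u x) ^ 2 * x ^ 2) (Ioi 0) ∧
    MemLp u 2 besselMeasure}

/-- The Bessel Dirichlet form `E(u, v) = ∫_I u' v' x² dx` (as a bilinear form). -/
def besselForm (u v : ℝ → ℝ) : ℝ :=
  ∫ x in Ioi (0 : ℝ), deriv u x * deriv v x * x ^ 2

/-- The shifted form `E_r(u, v) = E(u, v) + r ⟨u, v⟩` with the inner product of `L²(I, m)`. -/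
def besselFormShift (r : ℝ) (u v : ℝ → ℝ) : ℝ :=
  besselForm u v + r * ∫ x, u x * v x ∂besselMeasure

/-! ### The discrete measure, the restriction operator and the approximating forms -/

instance : MeasurableSpace ℕ+ := ⊤

instance : DiscreteMeasurableSpace ℕ+ := ⟨fun _ => trivial⟩

/-- The measure `μ = ∑_{k ≥ 1} a_k δ_k` on `{1, 2, 3, …}`. -/
def atomicMeasure (a : ℕ+ → ℝ) : Measure ℕ+ :=
  Measure.sum fun k => ENNReal.ofReal (a k) • Measure.dirac k

/-- The domain `D(J)` of the restriction operator `J`. -/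
def restrictionDomain (a : ℕ+ → ℝ) : Set (ℝ → ℝ) :=
  {u | u ∈ BesselDomain ∧ Summable fun k : ℕ+ => a k * u (k : ℝ) ^ 2}

/-- `J u = f`: the function `u` belongs to `D(J)` and the element `f` of `ℓ²(μ)` is the
restriction of `u` to `{1, 2, 3, …}`. -/
def IsRestriction (a : ℕ+ → ℝ) (u : ℝ → ℝ) (f : Lp ℝ 2 (atomicMeasure a)) : Prop :=
  u ∈ restrictionDomain a ∧ ∀ k : ℕ+, f k = u (k : ℝ)

/-- The kernel of `J`. -/
def restrictionKer : Set (ℝ → ℝ) :=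
  {u | u ∈ BesselDomain ∧ ∀ k : ℕ+, u (k : ℝ) = 0}

/-- `w = P_r u`: the function `w` is the orthogonal projection of `u` onto the `E_r`-orthogonal
complement of the (closed) subspace `ker J` of the Bessel domain. -/
def IsOrthProj (r : ℝ) (u w : ℝ → ℝ) : Prop :=
  w ∈ BesselDomain ∧ (∀ v ∈ restrictionKer, besselFormShift r w v = 0) ∧
    (fun x => u x - w x) ∈ restrictionKer

/-- The approximating quadratic form, `J u ↦ E_r[P_r u]` for `u ∈ D(J)`, as an extended-valued
functional on `ℓ²(μ)`, equal to `∞` off the range of `J`. All admissible pairs `(u, w)` give the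
same value; the infimum only serves to assign the value `∞` when there is none. -/
def traceApprox (a : ℕ+ → ℝ) (r : ℝ) (f : Lp ℝ 2 (atomicMeasure a)) : ℝ≥0∞ :=
  ⨅ (u : ℝ → ℝ) (w : ℝ → ℝ) (_ : IsRestriction a u f) (_ : IsOrthProj r u w),
    ENNReal.ofReal (besselFormShift r w w)

/-! ### Mosco limits -/

/-- `G` is the Mosco limit of the functionals `F r` as `r ↓ 0`. -/
def IsMoscoLimit {H : Type*} [NormedAddCommGroup H] [InnerProductSpace ℝ H]
    (F : ℝ → H → ℝ≥0∞) (G : H → ℝ≥0∞) : Prop :=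
  ∀ r : ℕ → ℝ, (∀ n, 0 < r n) → Tendsto r atTop (𝓝 0) →
    (∀ (f : H) (s : ℕ → H), (∀ g : H, Tendsto (fun n => inner ℝ (s n) g) atTop (𝓝 (inner ℝ f g))) →
      G f ≤ liminf (fun n => F (r n) (s n)) atTop) ∧
    (∀ f : H, ∃ s : ℕ → H, Tendsto s atTop (𝓝 f) ∧
      limsup (fun n => F (r n) (s n)) atTop ≤ G f)

/-- The limit functional: `moscoLim F f` is the smallest value of `liminf F (r n) (s n)` along
sequences `r n ↓ 0` and `s n → f`. It is the Mosco limit of `F r` as `r ↓ 0` whenever the latter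
exists, see `IsMoscoLimit.moscoLim_eq`. -/
def moscoLim {H : Type*} [NormedAddCommGroup H] (F : ℝ → H → ℝ≥0∞) (f : H) : ℝ≥0∞ :=
  ⨅ (r : ℕ → ℝ) (s : ℕ → H) (_ : ∀ n, 0 < r n) (_ : Tendsto r atTop (𝓝 0))
    (_ : Tendsto s atTop (𝓝 f)), liminf (fun n => F (r n) (s n)) atTop

theorem IsMoscoLimit.moscoLim_eq {H : Type*} [NormedAddCommGroup H] [InnerProductSpace ℝ H]
    {F : ℝ → H → ℝ≥0∞} {G : H → ℝ≥0∞} (h : IsMoscoLimit F G) : moscoLim F = G := by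
  funext f
  apply le_antisymm
  · have h0 : ∀ n : ℕ, (0 : ℝ) < 1 / ((n : ℝ) + 1) := fun n => by positivity
    have h1 : Tendsto (fun n : ℕ => 1 / ((n : ℝ) + 1)) atTop (𝓝 0) :=
      tendsto_one_div_add_atTop_nhds_zero_nat
    obtain ⟨s, hs, hl⟩ := (h _ h0 h1).2 f
    refine le_trans ?_ (le_trans (liminf_le_limsup) hl)
    exact iInf_le_of_le _ (iInf_le_of_le s (iInf_le_of_le h0 (iInf_le_of_le h1 (iInf_le _ hs))))
  · refine le_iInf fun r => le_iInf fun s => le_iInf fun h0 => le_iInf fun h1 => le_iInf fun hs => ?_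
    exact (h r h0 h1).1 f s fun g => hs.inner tendsto_const_nhds

/-- The trace of the Bessel Dirichlet form with respect to `μ`: the Mosco limit of the approximating
forms as `r ↓ 0`, as an extended-valued functional on `ℓ²(μ)`. -/
def traceForm (a : ℕ+ → ℝ) : Lp ℝ 2 (atomicMeasure a) → ℝ≥0∞ :=
  moscoLim (traceApprox a)

/-! ### Compact embeddings -/

/-- The domain `{Q < ∞}` of an extended-valued quadratic form `Q` on `L²(ν)`. -/
def formDomain {X : Type*} [MeasurableSpace X] {ν : Measure X} (Q : Lp ℝ 2 ν → ℝ≥0∞) :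
    Set (Lp ℝ 2 ν) :=
  {f | Q f < ∞}

/-- The square `Q₁[f] = Q[f] + ‖f‖²` of the form norm. -/
def formNormSq {X : Type*} [MeasurableSpace X] {ν : Measure X} (Q : Lp ℝ 2 ν → ℝ≥0∞)
    (f : Lp ℝ 2 ν) : ℝ≥0∞ :=
  Q f + ‖f‖ₑ ^ 2

/-- The domain of `Q`, with the form norm, is compactly embedded in `L^p(ν)`: it is contained in
`L^p(ν)`, the inclusion is bounded, and every sequence which is bounded in the form norm has a
subsequence which converges in `L^p(ν)`. -/
def EmbedsCompactly {X : Type*} [MeasurableSpace X] {ν : Measure X} (Q : Lp ℝ 2 ν → ℝ≥0∞)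
    (p : ℝ≥0∞) : Prop :=
  (∀ f ∈ formDomain Q, MemLp f p ν) ∧
  (∃ C : ℝ≥0, ∀ f ∈ formDomain Q, eLpNorm f p ν ≤ C * formNormSq Q f ^ (1 / 2 : ℝ)) ∧
  (∀ s : ℕ → Lp ℝ 2 ν, (∀ n, s n ∈ formDomain Q) → (∃ R : ℝ≥0, ∀ n, formNormSq Q (s n) ≤ R) →
    ∃ φ : ℕ → ℕ, StrictMono φ ∧ ∃ g : X → ℝ, MemLp g p ν ∧
      Tendsto (fun n => eLpNorm (fun x => s (φ n) x - g x) p ν) atTop (𝓝 0))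

end

/-! ### The pointwise bound on the Bessel domain -/

/-! Everything rests on the pointwise bound `x * u x ^ 2 ≤ besselForm u u`. It is Cauchy–Schwarz for
`∫ u'` from `x` outwards with weight `y²`, since `∫ y⁻²` over `(x, ∞)` is `1/x`; the boundary value
at infinity vanishes along a sequence because `u` is in `L²(I, m)`.

The bound depends only on the values of `u` on the integers, so it gives `k * f k ^ 2 ≤ traceApprox
a r f` uniformly in `r`, and passes to the limit form. Hence a ball of the form norm is dominated by
a multiple of `k ^ (-1/2)`, which the summability hypothesis places in `ℓ^p(μ)`. Domination yields
the bounded inclusion, and with a diagonal subsequence and dominated convergence also compactness.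
-/

/-- A function in `L²(I, m)` takes arbitrarily small values arbitrarily far out. -/
theorem exists_abs_lt_of_memLp_besselMeasure {u : ℝ → ℝ} (hu : MemLp u 2 besselMeasure) (N : ℝ)
    {ε : ℝ} (hε : 0 < ε) : ∃ c, N < c ∧ |u c| < ε := by
  by_contra! h
  have h1 := hu.meas_ge_lt_top (by norm_num) (by norm_num) (ε := ⟨ε, hε.le⟩)
    (by intro h0; exact hε.ne' (congrArg NNReal.toReal h0))
  have hsub : Ioi (max N 1) ⊆ {x | (⟨ε, hε.le⟩ : ℝ≥0) ≤ ‖u x‖₊} := by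
    intro x hx
    have : ε ≤ |u x| := h x ((le_max_left _ _).trans_lt hx)
    exact this
  have h2 := (measure_mono hsub).trans_lt h1
  rw [besselMeasure, withDensity_apply _ measurableSet_Ioi] at h2
  refine absurd h2 (not_lt.2 ?_)
  -- The density `2x²` exceeds `1` beyond `1`, so this half-line has infinite mass, against
  -- Chebyshev.
  rw [Measure.restrict_restrict measurableSet_Ioi,
    inter_eq_left.2 (Ioi_subset_Ioi (zero_le_one.trans (le_max_right N 1)))]
  calc (∞ : ℝ≥0∞) = ∫⁻ _ in Ioi (max N 1), 1 := by simp
    _ ≤ _ := by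
      refine setLIntegral_mono' measurableSet_Ioi fun x hx => ?_
      have : 1 < x := (le_max_right _ _).trans_lt hx
      rw [ENNReal.one_le_ofReal]
      nlinarith

/-- The increments of a function of finite energy, estimated by the energy and the integral of
`y⁻²`. -/
theorem abs_sub_le_of_mem_besselDomain {u : ℝ → ℝ} (hu : u ∈ BesselDomain) {x c t : ℝ}
    (hx : 0 < x) (hxc : x ≤ c) (ht : 0 < t) :
    |u c - u x| ≤ (t * besselForm u u + t⁻¹ * x⁻¹) / 2 := by
  obtain ⟨hac, hint, -⟩ := hu
  have hac := hac x c hx hxc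
  have hsub : Ioc x c ⊆ Ioi 0 := fun y hy => hx.trans hy.1
  have hI1 : IntervalIntegrable (fun y => (deriv u y) ^ 2 * y ^ 2) volume x c :=
    (intervalIntegrable_iff_integrableOn_Ioc_of_le hxc).2 (hint.mono_set hsub)
  have h0 : (0 : ℝ) ∉ uIcc x c := by
    rw [uIcc_of_le hxc]
    exact fun h => hx.not_ge h.1
  have hI2 : IntervalIntegrable (fun y : ℝ => y ^ (-2 : ℤ)) volume x c :=
    intervalIntegral.intervalIntegrable_zpow (Or.inr h0)
  have hE : ∫ y in x..c, (deriv u y) ^ 2 * y ^ 2 ≤ besselForm u u := by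
    rw [intervalIntegral.integral_of_le hxc, besselForm]
    simp_rw [← sq]
    exact setIntegral_mono_set hint (Eventually.of_forall fun y => by positivity)
      hsub.eventuallyLE
  have hT : ∫ y in x..c, y ^ (-2 : ℤ) ≤ x⁻¹ := by
    rw [integral_zpow (Or.inr ⟨by norm_num, h0⟩)]
    have : 0 < c⁻¹ := inv_pos.2 (hx.trans_le hxc)
    norm_num
    linarith
  rw [← hac.integral_deriv_eq_sub]
  calc |∫ y in x..c, deriv u y| ≤ ∫ y in x..c, |deriv u y| :=
        intervalIntegral.abs_integral_le_integral_abs hxc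
    _ ≤ ∫ y in x..c, (t / 2 * ((deriv u y) ^ 2 * y ^ 2) + t⁻¹ / 2 * y ^ (-2 : ℤ)) := by
        refine intervalIntegral.integral_mono_on hxc hac.intervalIntegrable_deriv.abs
          ((hI1.const_mul _).add (hI2.const_mul _)) fun y hy => ?_
        have hy0 : 0 < y := hx.trans_le hy.1
        -- Weighted AM–GM stands in for Cauchy–Schwarz; the parameter `t` is optimised later.
        have key : 0 ≤ t⁻¹ / 2 * (t * |deriv u y| * y - y⁻¹) ^ 2 := by positivity
        have e : t⁻¹ / 2 * (t * |deriv u y| * y - y⁻¹) ^ 2 =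
            t / 2 * ((deriv u y) ^ 2 * y ^ 2) + t⁻¹ / 2 * y ^ (-2 : ℤ) - |deriv u y| := by
          rw [← sq_abs (deriv u y), zpow_neg]
          norm_cast
          field_simp
          ring
        linarith
    _ = t / 2 * (∫ y in x..c, (deriv u y) ^ 2 * y ^ 2) +
          t⁻¹ / 2 * ∫ y in x..c, y ^ (-2 : ℤ) := by
        rw [intervalIntegral.integral_add (hI1.const_mul _) (hI2.const_mul _),
          intervalIntegral.integral_const_mul, intervalIntegral.integral_const_mul]
    _ ≤ t / 2 * besselForm u u + t⁻¹ / 2 * x⁻¹ := by gcongr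
    _ = _ := by ring

/-- Moving the far endpoint through points where `u` is arbitrarily small removes `u c` from the
increment estimate; `t` is then chosen. -/
theorem mul_sq_le_besselForm {u : ℝ → ℝ} (hu : u ∈ BesselDomain) {x : ℝ} (hx : 0 < x) :
    x * u x ^ 2 ≤ besselForm u u := by
  have hmain : ∀ t, 0 < t → |u x| ≤ (t * besselForm u u + t⁻¹ * x⁻¹) / 2 := by
    refine fun t ht => le_of_forall_pos_le_add fun ε hε => ?_
    obtain ⟨c, hc, hcε⟩ := exists_abs_lt_of_memLp_besselMeasure hu.2.2 x hε
    have h1 := abs_sub_le_of_mem_besselDomain hu hx hc.le ht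
    have h2 := abs_sub_abs_le_abs_sub (u x) (u c)
    rw [abs_sub_comm] at h2
    linarith
  rcases eq_or_ne (u x) 0 with h0 | h0
  · rw [h0]
    simpa [besselForm] using setIntegral_nonneg measurableSet_Ioi fun y _ =>
      mul_nonneg (mul_self_nonneg (deriv u y)) (sq_nonneg y)
  · have hd : 0 < |u x| := abs_pos.2 h0
    -- This `t` turns the `t⁻¹` term into `|u x| / 2`, which is absorbed on the left without
    -- dividing by the energy.
    have h := hmain (x * |u x|)⁻¹ (by positivity)
    rw [← sq_abs]
    have e : ((x * |u x|)⁻¹ * besselForm u u + (x * |u x|)⁻¹⁻¹ * x⁻¹) / 2 =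
        (besselForm u u / (x * |u x|) + |u x|) / 2 := by
      field_simp
    rw [e] at h
    have h' : |u x| ≤ besselForm u u / (x * |u x|) := by linarith
    rw [le_div_iff₀ (by positivity)] at h'
    linarith

theorem besselForm_le_besselFormShift {r : ℝ} (hr : 0 ≤ r) (u : ℝ → ℝ) :
    besselForm u u ≤ besselFormShift r u u :=
  le_add_of_nonneg_right (mul_nonneg hr (integral_nonneg fun x => mul_self_nonneg (u x)))

/-! ### The atomic measure -/

theorem atomicMeasure_singleton (a : ℕ+ → ℝ) (k : ℕ+) :
    atomicMeasure a {k} = ENNReal.ofReal (a k) := by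
  rw [atomicMeasure, Measure.sum_apply _ (measurableSet_singleton k), tsum_eq_single k]
  · simp
  · intro j hj
    simp [hj]

theorem lintegral_atomicMeasure (a : ℕ+ → ℝ) (F : ℕ+ → ℝ≥0∞) :
    ∫⁻ k, F k ∂atomicMeasure a = ∑' k, ENNReal.ofReal (a k) * F k := by
  simp [atomicMeasure, lintegral_sum_measure]

/-- Convergence in `ℓ²(μ)` implies pointwise convergence. -/
theorem tendsto_apply_of_tendsto_atomicMeasure {a : ℕ+ → ℝ} (ha : ∀ k, 0 < a k)
    {s : ℕ → Lp ℝ 2 (atomicMeasure a)} {f : Lp ℝ 2 (atomicMeasure a)}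
    (hs : Tendsto s atTop (𝓝 f)) (k : ℕ+) : Tendsto (fun n => s n k) atTop (𝓝 (f k)) := by
  have h := tendstoInMeasure_of_tendsto_Lp hs
  rw [tendstoInMeasure_iff_norm] at h
  refine Metric.tendsto_nhds.2 fun ε hε => ?_
  have hk : (0 : ℝ≥0∞) < ENNReal.ofReal (a k) := ENNReal.ofReal_pos.2 (ha k)
  filter_upwards [(h ε hε).eventually_lt_const hk] with n hn
  by_contra hcon
  -- A set of measure below `a k` cannot contain the atom `k`.
  refine hn.not_ge ?_
  rw [← atomicMeasure_singleton]
  exact measure_mono (singleton_subset_iff.2 (not_lt.1 hcon))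

/-! ### The pointwise bound for the trace form -/

/-- The projection differs from `u` by an element of `ker J`, so it still takes the values `f k`,
and the pointwise bound applies to it. Off the range of `J` the infimum is `∞`. -/
theorem ofReal_mul_sq_le_traceApprox (a : ℕ+ → ℝ) {r : ℝ} (hr : 0 < r)
    (f : Lp ℝ 2 (atomicMeasure a)) (k : ℕ+) :
    ENNReal.ofReal (k * f k ^ 2) ≤ traceApprox a r f := by
  refine le_iInf fun u => le_iInf fun w => le_iInf fun hu => le_iInf fun hw => ?_
  refine ENNReal.ofReal_le_ofReal (le_trans ?_ (besselForm_le_besselFormShift hr.le w))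
  have hk : (0 : ℝ) < k := by exact_mod_cast k.pos
  have h1 : f k = w k := (hu.2 k).trans (sub_eq_zero.1 (hw.2.2.2 k))
  rw [h1]
  exact mul_sq_le_besselForm hw.1 hk

/-- The left side is continuous in `f` and the bound is uniform in `r`, so it survives every
`liminf` defining the limit. -/
theorem ofReal_mul_sq_le_traceForm {a : ℕ+ → ℝ} (ha : ∀ k, 0 < a k)
    (f : Lp ℝ 2 (atomicMeasure a)) (k : ℕ+) :
    ENNReal.ofReal (k * f k ^ 2) ≤ traceForm a f := by
  refine le_iInf fun r => le_iInf fun s => le_iInf fun hr => le_iInf fun _ => le_iInf fun hs => ?_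
  have h : Tendsto (fun n => ENNReal.ofReal (k * s n k ^ 2)) atTop
      (𝓝 (ENNReal.ofReal (k * f k ^ 2))) :=
    ENNReal.tendsto_ofReal (((tendsto_apply_of_tendsto_atomicMeasure ha hs k).pow 2).const_mul _)
  rw [← h.liminf_eq]
  exact liminf_le_liminf (Eventually.of_forall fun n =>
    ofReal_mul_sq_le_traceApprox a (hr n) (s n) k)

/-- Elements of the form domain decay like `k ^ (-1/2)`. -/
theorem abs_apply_le_of_formNormSq_le {a : ℕ+ → ℝ} (ha : ∀ k, 0 < a k)
    {f : Lp ℝ 2 (atomicMeasure a)} {R : ℝ≥0} (hf : formNormSq (traceForm a) f ≤ R) (k : ℕ+) :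
    |f k| ≤ √R * (√k)⁻¹ := by
  have hk : (0 : ℝ) < k := by exact_mod_cast k.pos
  have h := (ofReal_mul_sq_le_traceForm ha f k).trans (le_self_add.trans hf)
  rw [← ENNReal.ofReal_coe_nnreal, ENNReal.ofReal_le_ofReal_iff R.coe_nonneg] at h
  rw [← div_eq_mul_inv, le_div_iff₀ (Real.sqrt_pos.2 hk)]
  refine Real.le_sqrt_of_sq_le ?_
  rw [mul_pow, sq_abs, Real.sq_sqrt hk.le]
  linarith

theorem memLp_inv_sqrt {a : ℕ+ → ℝ} {p : ℝ} (ha : ∀ k, 0 < a k) (hp : 1 ≤ p)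
    (hsum : Summable fun k : ℕ+ => a k / (k : ℝ) ^ (p / 2)) :
    MemLp (fun k : ℕ+ => (√(k : ℝ))⁻¹) (ENNReal.ofReal p) (atomicMeasure a) := by
  have hp0 : 0 < p := zero_lt_one.trans_le hp
  refine ⟨.of_discrete, ?_⟩
  rw [eLpNorm_lt_top_iff_lintegral_rpow_enorm_lt_top (ENNReal.ofReal_pos.2 hp0).ne'
    ENNReal.ofReal_ne_top, ENNReal.toReal_ofReal hp0.le, lintegral_atomicMeasure]
  have e : ∀ k : ℕ+, ENNReal.ofReal (a k) * ‖(√(k : ℝ))⁻¹‖ₑ ^ p =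
      ENNReal.ofReal (a k / (k : ℝ) ^ (p / 2)) := by
    intro k
    have hk : (0 : ℝ) < k := by exact_mod_cast k.pos
    rw [Real.enorm_eq_ofReal (by positivity), ENNReal.ofReal_rpow_of_nonneg (by positivity) hp0.le,
      ← ENNReal.ofReal_mul (ha k).le, Real.inv_rpow (Real.sqrt_nonneg _), Real.sqrt_eq_rpow,
      ← Real.rpow_mul hk.le, one_div_mul_eq_div, ← div_eq_mul_inv]
  simp_rw [e]
  exact hsum.tsum_ofReal_lt_top

/-! ### Compactness -/

/-- Pointwise convergence together with domination by an `L^p` function gives convergence in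
`L^p`. -/
theorem tendsto_eLpNorm_sub_of_dominated {X : Type*} [MeasurableSpace X] {ν : Measure X}
    {p : ℝ≥0∞} (hp0 : p ≠ 0) (hp : p ≠ ∞) {F : ℕ → X → ℝ} {g b : X → ℝ}
    (hF : ∀ n, AEStronglyMeasurable (F n) ν) (hb : MemLp b p ν)
    (hFb : ∀ n, ∀ᵐ x ∂ν, |F n x| ≤ b x)
    (hlim : ∀ᵐ x ∂ν, Tendsto (fun n => F n x) atTop (𝓝 (g x))) :
    Tendsto (fun n => eLpNorm (fun x => F n x - g x) p ν) atTop (𝓝 0) := by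
  have hpos : 0 < p.toReal := ENNReal.toReal_pos hp0 hp
  have hg : AEStronglyMeasurable g ν := aestronglyMeasurable_of_tendsto_ae atTop hF hlim
  have hb2 := (eLpNorm_lt_top_iff_lintegral_rpow_enorm_lt_top hp0 hp).1
    (hb.const_mul 2).eLpNorm_lt_top
  have hmain := tendsto_lintegral_of_dominated_convergence'
    (F := fun n x => ‖F n x - g x‖ₑ ^ p.toReal) (f := fun _ => 0) (μ := ν)
    (fun x => ‖2 * b x‖ₑ ^ p.toReal)
    (fun n => ((hF n).sub hg).enorm.pow_const _)
    (fun n => by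
      filter_upwards [ae_all_iff.2 hFb, hlim] with x hx hlx
      -- The limit obeys the same bound, so `2 * b` dominates the differences.
      have h1 : |g x| ≤ b x := le_of_tendsto hlx.abs (Eventually.of_forall hx)
      refine ENNReal.rpow_le_rpow ?_ hpos.le
      rw [enorm_le_iff_norm_le, Real.norm_eq_abs, Real.norm_eq_abs]
      have h2 := hx n
      have h3 := abs_sub (F n x) (g x)
      have h4 := le_abs_self (2 * b x)
      linarith) hb2.ne
    (by
      filter_upwards [hlim] with x hx
      have h1 : Tendsto (fun n => ‖F n x - g x‖ₑ) atTop (𝓝 0) := by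
        simpa using (hx.sub_const (g x)).enorm
      simpa [ENNReal.zero_rpow_of_pos hpos] using h1.ennrpow_const p.toReal)
  simp_rw [eLpNorm_eq_lintegral_rpow_enorm_toReal hp0 hp]
  have := hmain.ennrpow_const (1 / p.toReal)
  simpa [ENNReal.zero_rpow_of_pos (inv_pos.2 hpos)] using this

/-- A pointwise bounded sequence of functions on a countable type has a pointwise convergent
subsequence. -/
theorem exists_subseq_tendsto_of_abs_le {ι : Type*} [Countable ι] {F : ℕ → ι → ℝ} {b : ι → ℝ}
    (h : ∀ n i, |F n i| ≤ b i) :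
    ∃ g : ι → ℝ, ∃ φ : ℕ → ℕ, StrictMono φ ∧
      ∀ i, Tendsto (fun n => F (φ n) i) atTop (𝓝 (g i)) := by
  -- Tychonoff; countability makes the product metrizable, hence the compact box sequentially
  -- compact.
  obtain ⟨g, -, φ, hφ, hlim⟩ :=
    (isCompact_univ_pi fun i => isCompact_Icc (a := -b i) (b := b i)).tendsto_subseq
      (x := F) fun n i _ => abs_le.1 (h n i)
  exact ⟨g, φ, hφ, tendsto_pi_nhds.1 hlim⟩

theorem mainTheorem11 (a : ℕ+ → ℝ) (ha : ∀ k, 0 < a k) (p : ℝ) (hp : 1 ≤ p)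
    (hsum : Summable fun k : ℕ+ => a k / (k : ℝ) ^ (p / 2)) :
    EmbedsCompactly (traceForm a) (ENNReal.ofReal p) := by
  have hp0 : 0 < p := zero_lt_one.trans_le hp
  have he := memLp_inv_sqrt ha hp hsum
  have hbound : ∀ f ∈ formDomain (traceForm a),
      eLpNorm f (ENNReal.ofReal p) (atomicMeasure a) ≤
        eLpNorm (fun k : ℕ+ => (√(k : ℝ))⁻¹) (ENNReal.ofReal p) (atomicMeasure a) *
          formNormSq (traceForm a) f ^ (1 / 2 : ℝ) := by
    intro f hf
    have hfin : formNormSq (traceForm a) f ≠ ∞ :=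
      ENNReal.add_ne_top.2 ⟨ne_of_lt hf, ENNReal.pow_ne_top enorm_ne_top⟩
    lift formNormSq (traceForm a) f to ℝ≥0 using hfin with R hR
    have h := eLpNorm_le_mul_eLpNorm_of_ae_le_mul (μ := atomicMeasure a) (f := f)
      (g := fun k : ℕ+ => (√(k : ℝ))⁻¹) (c := √R)
      (Eventually.of_forall fun k => by
        have := abs_apply_le_of_formNormSq_le ha hR.ge k
        rwa [Real.norm_eq_abs, Real.norm_of_nonneg (by positivity)]) (ENNReal.ofReal p)
    rw [mul_comm]
    convert h using 2
    rw [Real.sqrt_eq_rpow, ← ENNReal.ofReal_rpow_of_nonneg R.coe_nonneg (by norm_num),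
      ENNReal.ofReal_coe_nnreal]
  refine ⟨fun f hf => ⟨.of_discrete, (hbound f hf).trans_lt ?_⟩, ?_, ?_⟩
  · refine ENNReal.mul_lt_top he.eLpNorm_lt_top (ENNReal.rpow_lt_top_of_nonneg (by norm_num) ?_)
    exact ENNReal.add_ne_top.2 ⟨ne_of_lt hf, ENNReal.pow_ne_top enorm_ne_top⟩
  · refine ⟨(eLpNorm (fun k : ℕ+ => (√(k : ℝ))⁻¹) (ENNReal.ofReal p) (atomicMeasure a)).toNNReal,
      fun f hf => ?_⟩
    rw [ENNReal.coe_toNNReal he.eLpNorm_ne_top]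
    exact hbound f hf
  · rintro s - ⟨R, hR⟩
    have hs : ∀ n k, |s n k| ≤ √R * (√(k : ℝ))⁻¹ := fun n k =>
      abs_apply_le_of_formNormSq_le ha (hR n) k
    obtain ⟨g, φ, hφ, hlim⟩ := exists_subseq_tendsto_of_abs_le hs
    have hb := he.const_mul √R
    refine ⟨φ, hφ, g, hb.mono' .of_discrete (Eventually.of_forall fun k => ?_), ?_⟩
    · exact le_of_tendsto (hlim k).abs (Eventually.of_forall fun n => hs (φ n) k)
    · exact tendsto_eLpNorm_sub_of_dominated (ENNReal.ofReal_pos.2 hp0).ne' ENNReal.ofReal_ne_top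
        (fun _ => .of_discrete) hb (fun n => Eventually.of_forall (hs (φ n)))
        (Eventually.of_forall hlim)
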